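/- Theorem (the normal crossing divisors are the only Abelian linear free divisors). Let $V=\mathbb{C}^n$ with coordinate ring $\mathbb{C}[V]=\mathbb{C}[x_1,\dots,x_n]$, and let $D\subset V$ be the divisor defined by a reduced (that is, squarefree, in particular nonzero) polynomial $f\in\mathbb{C}[V]$. Call $D$ a \emph{linear free divisor} if the $\mathbb{C}[V]$-module $$\operatorname{Der}(-\log D)=\{\delta\in\operatorname{Der}_{\mathbb{C}}(\mathbb{C}[V]) : \delta(f)\in(f)\}$$ of logarithmic vector fields is free with a basis $\delta_1,\dots,\delta_n$ of linear vector fields, i.e. such that every coefficient $\delta_i(x_j)$ is zero or a homogeneous polynomial of degree $1$. Let $G$ be the largest (Zariski) connected subgroup of $\operatorname{GL}(V)$ preserving the zero set of $f$, and let $H$ be the largest connected subgroup of the isotropy group $\operatorname{GL}(V)_f=\{g\in \operatorname{GL}(V): f(gx)=f(x)\ \text{for all } x\in V\}$. Then the following are equivalent: 1. $D$ is a linear free divisor and $G$ is Abelian; 2. $D$ is a linear free divisor and $H$ is Abelian; 3. $D$ is a normal crossing divisor in the following sense: there are linear coordinates $y_1,\dots,y_n$ on $V$ and a constant $c\in\mathbb{C}\setminus\{0\}$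 such that $f=c\,y_1\cdots y_n$. -/

import Mathlib

namespace LinearFreeDivisor

open MvPolynomial

/-- The coordinate ring `ℂ[x₁, …, xₙ]` of affine `n`-space `V = ℂⁿ`. -/
abbrev Coord (n : ℕ) : Type := MvPolynomial (Fin n) ℂ

/-- The hypersurface `D ⊆ V = ℂⁿ` defined by `f`. -/
def hypersurface {n : ℕ} (f : Coord n) : Set (Fin n → ℂ) := {x | eval x f = 0}

/-- Algebraic vector fields on `V`: the `ℂ`-linear derivations of the coordinate ring. -/
abbrev VectorField (n : ℕ) : Type := Derivation ℂ (Coord n) (Coord n)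

/-- A vector field is linear if all its coefficients `δ(xⱼ)` are linear forms (or zero). -/
def IsLinearField {n : ℕ} (δ : VectorField n) : Prop :=
  ∀ j : Fin n, (δ (X j)).IsHomogeneous 1

/-- `Der(-log D)`: the logarithmic vector fields along the divisor with reduced equation `f`, that
is, the vector fields `δ` that preserve the ideal `(f)`. As `V` is affine, the (quasi-coherent)
sheaf of logarithmic vector fields is given by this module of global sections. -/
def logFields {n : ℕ} (f : Coord n) : Submodule (Coord n) (VectorField n) where
  carrier := {δ | f ∣ δ f}
  add_mem' {a b} ha hb := by
    simpa only [Set.mem_ofPred_eq, Derivation.add_apply] using dvd_add ha hb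
  zero_mem' := by simp
  smul_mem' c a ha := by
    simpa only [Set.mem_ofPred_eq, Derivation.smul_apply, smul_eq_mul] using
      Dvd.dvd.mul_left ha c

/-- The divisor with reduced equation `f` is linear free: `Der(-log D)` has a basis
`δ₁, …, δₙ` consisting of linear vector fields. -/
def IsLinearFree {n : ℕ} (f : Coord n) : Prop :=
  ∃ δ : Module.Basis (Fin n) (Coord n) (logFields f), ∀ i, IsLinearField (δ i : VectorField n)

/-- The Zariski topology on `GLₙ(ℂ)`: the sets `{g | p(g) ≠ 0}`, for `p` a polynomial in the
matrix entries, form a basis of open sets. -/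
def zariski (n : ℕ) : TopologicalSpace (GL (Fin n) ℂ) :=
  TopologicalSpace.generateFrom
    {U | ∃ p : MvPolynomial (Fin n × Fin n) ℂ,
      U = {g : GL (Fin n) ℂ | eval (fun ij => g ij.1 ij.2) p ≠ 0}}

/-- The largest (Zariski) connected subgroup `K°` of a subgroup `K` of `GLₙ(ℂ)`. -/
def connectedPart {n : ℕ} (K : Subgroup (GL (Fin n) ℂ)) : Subgroup (GL (Fin n) ℂ) :=
  sSup {L | L ≤ K ∧ @IsConnected (GL (Fin n) ℂ) (zariski n) (L : Set (GL (Fin n) ℂ))}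

/-- The subgroup of all `g ∈ GL(V)` with `g(D) = D`. -/
def preserver {n : ℕ} (D : Set (Fin n → ℂ)) : Subgroup (GL (Fin n) ℂ) where
  carrier := {g | (fun x => g.val.mulVec x) '' D = D}
  one_mem' := by simp
  mul_mem' {a b} ha hb := by
    have h : (fun x => (a * b).val.mulVec x) =
        (fun x => a.val.mulVec x) ∘ (fun x => b.val.mulVec x) := by
      funext x
      simp [Matrix.mulVec_mulVec]
    simp only [Set.mem_ofPred_eq] at ha hb ⊢
    rw [h, Set.image_comp, hb, ha]
  inv_mem' {a} ha := by
    have h : (fun x => a⁻¹.val.mulVec x) ∘ (fun x => a.val.mulVec x) = id := by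
      funext x
      rw [Function.comp_apply, Matrix.mulVec_mulVec, a.inv_mul, Matrix.one_mulVec, id_eq]
    simp only [Set.mem_ofPred_eq] at ha ⊢
    conv_lhs => rw [← ha]
    rw [← Set.image_comp, h, Set.image_id]

/-- The isotropy group `GL(V)_f` of all `g ∈ GL(V)` with `f(g x) = f(x)` for all `x`. -/
def isotropy {n : ℕ} (f : Coord n) : Subgroup (GL (Fin n) ℂ) where
  carrier := {g | ∀ x : Fin n → ℂ, eval (g.val.mulVec x) f = eval x f}
  one_mem' := by simp
  mul_mem' {a b} ha hb x := by
    rw [← hb x, ← ha (b.val.mulVec x), Matrix.mulVec_mulVec, Units.val_mul]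
  inv_mem' {a} ha x := by
    rw [← ha (a⁻¹.val.mulVec x), Matrix.mulVec_mulVec, a.mul_inv, Matrix.one_mulVec]

/-- The group `G` of the divisor `D` with reduced equation `f`: the largest connected subgroup of
`GL(V)` preserving `D`. -/
def groupG {n : ℕ} (f : Coord n) : Subgroup (GL (Fin n) ℂ) :=
  connectedPart (preserver (hypersurface f))

/-- The group `H = (GL(V)_f)°`. -/
def groupH {n : ℕ} (f : Coord n) : Subgroup (GL (Fin n) ℂ) :=
  connectedPart (isotropy f)

/-- The divisor with reduced equation `f` is the normal crossing divisor: in suitable linear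
coordinates `yᵢ = ∑ⱼ gᵢⱼ xⱼ` on `V` it is defined by `y₁ ⋯ yₙ` (equations are unique up to units,
that is, nonzero constants). -/
def IsNormalCrossing {n : ℕ} (f : Coord n) : Prop :=
  ∃ g : GL (Fin n) ℂ, Associated f (∏ i, ∑ j, C (g i j) * X j)

end LinearFreeDivisor

namespace LinearFreeDivisor

open MvPolynomial

/-- The linear form `∑ⱼ aⱼ xⱼ`. -/
noncomputable def linForm {n : ℕ} (a : Fin n → ℂ) : Coord n := ∑ j, C (a j) * X j

theorem eval_linForm {n : ℕ} (a x : Fin n → ℂ) : eval x (linForm a) = a ⬝ᵥ x := by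
  simp [linForm, dotProduct]

theorem isHomogeneous_linForm {n : ℕ} (a : Fin n → ℂ) : (linForm a).IsHomogeneous 1 :=
  IsHomogeneous.sum _ _ _ fun j _ => isHomogeneous_C_mul_X (a j) j

theorem coeff_linForm {n : ℕ} (a : Fin n → ℂ) (k : Fin n) :
    coeff (Finsupp.single k 1) (linForm a) = a k := by
  simp [linForm, coeff_sum, coeff_C_mul, coeff_X, Finsupp.single_left_inj]

theorem linForm_injective {n : ℕ} : Function.Injective (linForm (n := n)) := fun a b h => by
  funext k
  rw [← coeff_linForm a, h, coeff_linForm]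

theorem linForm_zero {n : ℕ} : linForm (0 : Fin n → ℂ) = 0 := by simp [linForm]

theorem linForm_ne_zero {n : ℕ} {a : Fin n → ℂ} (ha : a ≠ 0) : linForm a ≠ 0 := fun h =>
  ha (linForm_injective (h.trans linForm_zero.symm))

theorem linForm_smul {n : ℕ} (t : ℂ) (a : Fin n → ℂ) : linForm (t • a) = C t * linForm a := by
  simp [linForm, Finset.mul_sum, mul_assoc]

theorem eq_linForm_of_isHomogeneous {n : ℕ} {p : Coord n} (hp : p.IsHomogeneous 1) :
    p = linForm fun k => coeff (Finsupp.single k 1) p := by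
  ext m
  by_cases hm : m.degree = 1
  · obtain ⟨k, rfl⟩ : ∃ k, m = Finsupp.single k 1 := by
      have h0 : m ≠ 0 := by rintro rfl; simp at hm
      obtain ⟨k, hk⟩ := Finsupp.ne_iff.1 h0
      have hle : Finsupp.single k 1 ≤ m := Finsupp.single_le_iff.2 (Nat.one_le_iff_ne_zero.2 hk)
      have hd := congrArg Finsupp.degree (tsub_add_cancel_of_le hle)
      rw [map_add, hm, Finsupp.degree_single] at hd
      have hz : m - Finsupp.single k 1 = 0 := (Finsupp.degree_eq_zero_iff _).1 (by omega)
      exact ⟨k, by rw [← tsub_add_cancel_of_le hle, hz, zero_add]⟩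
    rw [coeff_linForm]
  · rw [hp.coeff_eq_zero hm, (isHomogeneous_linForm _).coeff_eq_zero hm]

theorem irreducible_linForm {n : ℕ} {a : Fin n → ℂ} (ha : a ≠ 0) : Irreducible (linForm a) := by
  apply irreducible_of_totalDegree_eq_one
  · exact (isHomogeneous_linForm a).totalDegree (linForm_ne_zero ha)
  · intro x hx
    obtain ⟨k, hk⟩ := Function.ne_iff.1 ha
    have := hx (Finsupp.single k 1)
    rw [coeff_linForm] at this
    exact isUnit_of_dvd_unit this (isUnit_iff_ne_zero.2 hk)

/-- The vector field with value `a x` at the point `x`. -/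
noncomputable def linField {n : ℕ} (a : Matrix (Fin n) (Fin n) ℂ) : VectorField n :=
  mkDerivation ℂ fun j => linForm (a j)

theorem linField_X {n : ℕ} (a : Matrix (Fin n) (Fin n) ℂ) (j : Fin n) :
    linField a (X j) = linForm (a j) := mkDerivation_X _ _ _

theorem IsLinearField.exists_eq_linField {n : ℕ} {δ : VectorField n} (h : IsLinearField δ) :
    ∃ a, δ = linField a :=
  ⟨_, derivation_ext fun j => by
    rw [linField_X]; exact eq_linForm_of_isHomogeneous (h j)⟩

theorem linField_sub {n : ℕ} (a b : Matrix (Fin n) (Fin n) ℂ) :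
    linField (a - b) = linField a - linField b := by
  refine derivation_ext fun j => ?_
  simp [linField_X, linForm, sub_mul, Finset.sum_sub_distrib]

theorem linField_smul {n : ℕ} (t : ℂ) (a : Matrix (Fin n) (Fin n) ℂ) :
    linField (t • a) = t • linField a := by
  refine derivation_ext fun j => ?_
  simp [linField_X, linForm, Finset.smul_sum, mul_assoc, MvPolynomial.smul_eq_C_mul]

theorem derivation_apply_linForm {n : ℕ} (δ : VectorField n) (a : Fin n → ℂ) :
    δ (linForm a) = ∑ j, C (a j) * δ (X j) := by
  simp [linForm, map_sum, Derivation.leibniz]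

section Divisibility

variable {n : ℕ} {c f p : Coord n} {δ : VectorField n}

theorem mul_dvd_derivation_mul {a b : Coord n} (ha : a ∣ δ a) (hb : b ∣ δ b) :
    a * b ∣ δ (a * b) := by
  obtain ⟨s, hs⟩ := ha
  obtain ⟨t, ht⟩ := hb
  exact ⟨s + t, by rw [Derivation.leibniz, hs, ht]; simp only [smul_eq_mul]; ring⟩

theorem dvd_derivation_of_irreducible (hp : Irreducible p) (hc : c ≠ 0) (hpc : p ∣ c)
    (h : c ∣ δ c) : p ∣ δ p := by
  obtain ⟨k, q, hq, rfl⟩ := WfDvdMonoid.max_power_factor hc hp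
  have hp' := hp.prime
  rcases k with _ | k
  · simp at hpc; exact absurd hpc hq
  have h1 : p ^ (k + 1) ∣ δ (p ^ (k + 1) * q) := (dvd_mul_right _ _).trans h
  rw [Derivation.leibniz, Derivation.leibniz_pow] at h1
  simp only [smul_eq_mul, Nat.add_sub_cancel, nsmul_eq_mul] at h1
  have h2 : p ^ k * p ∣ p ^ k * (((k + 1 : ℕ) : Coord n) * (q * δ p)) := by
    rw [← pow_succ]
    refine ((dvd_add_right (dvd_mul_right (p ^ (k + 1)) (δ q))).1 h1).trans (dvd_of_eq ?_)
    ring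
  have h3 := (mul_dvd_mul_iff_left (pow_ne_zero k hp.ne_zero)).1 h2
  have hu : IsUnit (((k + 1 : ℕ) : Coord n)) := by
    rw [← map_natCast (C : ℂ →+* Coord n)]
    exact (isUnit_iff_ne_zero.2 (Nat.cast_ne_zero.2 k.succ_ne_zero)).map C
  rw [hu.dvd_mul_left] at h3
  exact (hp'.dvd_or_dvd h3).resolve_left hq

theorem dvd_of_squarefree_of_forall_irreducible (hf : Squarefree f)
    (h : ∀ p, Irreducible p → p ∣ f → p ∣ c) : f ∣ c := by
  induction f using WfDvdMonoid.induction_on_irreducible with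
  | zero => exact absurd hf not_squarefree_zero
  | unit u hu => exact hu.dvd
  | mul a i ha hi ih =>
    refine IsRelPrime.mul_dvd ?_ (h i hi (dvd_mul_right _ _))
      (ih (hf.squarefree_of_dvd (dvd_mul_left _ _))
        fun p hp hpa => h p hp (hpa.trans (dvd_mul_left _ _)))
    rw [hi.isRelPrime_iff_not_dvd]
    exact fun hd => hi.not_isUnit (hf i (mul_dvd_mul_left i hd))

theorem dvd_derivation_of_squarefree (hf : Squarefree f)
    (h : ∀ p, Irreducible p → p ∣ f → p ∣ δ p) : f ∣ δ f := by
  refine dvd_of_squarefree_of_forall_irreducible hf fun p hp ⟨q, hq⟩ => ?_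
  rw [hq, Derivation.leibniz]
  exact dvd_add (dvd_mul_right _ _) ((h p hp ⟨q, hq⟩).mul_left q)

theorem derivation_sum_apply {ι : Type*} (s : Finset ι) (δ : ι → VectorField n) (p : Coord n) :
    (∑ i ∈ s, δ i) p = ∑ i ∈ s, δ i p := by
  classical
  induction s using Finset.induction_on with
  | empty => simp
  | insert i s hi ih => rw [Finset.sum_insert hi, Finset.sum_insert hi, Derivation.add_apply, ih]

theorem derivation_eq_sum_pderiv (δ : VectorField n) (p : Coord n) :
    δ p = ∑ j, δ (X j) * pderiv j p := by
  have h : δ = ∑ j, δ (X j) • pderiv j := by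
    refine derivation_ext fun i => ?_
    rw [derivation_sum_apply, Finset.sum_eq_single i]
    · simp
    · intro j _ hj
      simp [pderiv_X_of_ne hj.symm]
    · simp
  conv_lhs => rw [h]
  simp [derivation_sum_apply]

theorem totalDegree_pderiv_le (j : Fin n) (p : Coord n) :
    (pderiv j p).totalDegree ≤ p.totalDegree - 1 := by
  conv_lhs => rw [← sum_homogeneousComponent p]
  rw [map_sum]
  refine totalDegree_finsetSum_le fun k hk => ?_
  refine (homogeneousComponent_isHomogeneous k p).pderiv.totalDegree_le.trans ?_
  have := Finset.mem_range.1 hk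
  omega

theorem linField_one_of_isHomogeneous {d : ℕ} (hp : p.IsHomogeneous d) :
    linField 1 p = d • p := by
  rw [derivation_eq_sum_pderiv, ← hp.sum_X_mul_pderiv]
  refine Finset.sum_congr rfl fun j _ => ?_
  rw [linField_X]
  simp [linForm, Matrix.one_apply]

theorem coeff_linField_one (p : Coord n) (m : Fin n →₀ ℕ) :
    coeff m (linField 1 p) = m.degree * coeff m p := by
  induction p using MvPolynomial.induction_on' with
  | monomial u a =>
    rw [linField_one_of_isHomogeneous (isHomogeneous_monomial a rfl), coeff_smul, coeff_monomial]
    split_ifs with h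
    · simp [h]
    · simp
  | add p q hp hq => rw [map_add, coeff_add, hp, hq, coeff_add, mul_add]

theorem totalDegree_eq_zero_of_linField_one (h : linField 1 p = 0) : p.totalDegree = 0 := by
  rw [totalDegree_eq_zero_iff]
  intro m hm x
  have h1 := coeff_linField_one p m
  rw [h, coeff_zero, eq_comm, mul_eq_zero, Nat.cast_eq_zero, Finsupp.degree_eq_zero_iff] at h1
  rw [h1.resolve_right (mem_support_iff.1 hm), Finsupp.zero_apply]

theorem isUnit_of_totalDegree_eq_zero (hp : p ≠ 0) (h : p.totalDegree = 0) : IsUnit p := by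
  rw [totalDegree_eq_zero_iff_eq_C] at h
  rw [h]
  refine (isUnit_iff_ne_zero.2 fun h0 => hp ?_).map C
  rw [h, h0, C_0]

theorem exists_not_dvd_pderiv (hp : Irreducible p) : ∃ j, ¬ p ∣ pderiv j p := by
  by_contra! h
  have hd : p.totalDegree ≠ 0 := fun h0 =>
    hp.not_isUnit (isUnit_of_totalDegree_eq_zero hp.ne_zero h0)
  refine hd (totalDegree_eq_zero_of_linField_one ?_)
  rw [derivation_eq_sum_pderiv]
  refine Finset.sum_eq_zero fun j _ => ?_
  obtain ⟨q, hq⟩ := h j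
  by_cases hq0 : q = 0
  · rw [hq, hq0, mul_zero, mul_zero]
  · have h1 := totalDegree_pderiv_le j p
    rw [hq, totalDegree_mul_of_isDomain hp.ne_zero hq0] at h1
    omega

theorem linField_apply_eq_C_mul_of_dvd {a : Matrix (Fin n) (Fin n) ℂ} (h : f ∣ linField a f) :
    ∃ t, linField a f = C t * f := by
  obtain ⟨q, hq⟩ := h
  by_cases h0 : f * q = 0
  · exact ⟨0, by rw [hq, h0, C_0, zero_mul]⟩
  have hle : (linField a f).totalDegree ≤ f.totalDegree := by
    by_cases hf : f.totalDegree = 0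
    · rw [totalDegree_eq_zero_iff_eq_C] at hf
      rw [hf, derivation_C]; simp
    rw [derivation_eq_sum_pderiv]
    refine totalDegree_finsetSum_le fun j _ => (totalDegree_mul _ _).trans ?_
    have h1 := totalDegree_pderiv_le j f
    have h2 : (linField a (X j)).totalDegree ≤ 1 := by
      rw [linField_X]; exact (isHomogeneous_linForm _).totalDegree_le
    omega
  rw [hq, totalDegree_mul_of_isDomain (left_ne_zero_of_mul h0) (right_ne_zero_of_mul h0)] at hle
  have h1 : q.totalDegree = 0 := by omega
  rw [totalDegree_eq_zero_iff_eq_C] at h1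
  exact ⟨coeff 0 q, by rw [hq, ← h1, mul_comm]⟩

end Divisibility

/-- The Saito determinant of a family of linear vector fields. -/
noncomputable def saitoDet {n : ℕ} (a : Fin n → Matrix (Fin n) (Fin n) ℂ) : Coord n :=
  (Matrix.of fun i j => linForm (a i j)).det

theorem eval_saitoDet {n : ℕ} (a : Fin n → Matrix (Fin n) (Fin n) ℂ) (x : Fin n → ℂ) :
    eval x (saitoDet a) = (Matrix.of fun i => (a i).mulVec x).det := by
  rw [saitoDet, RingHom.map_det]
  congr 1
  ext i j
  simp [eval_linForm, Matrix.mulVec]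

theorem isHomogeneous_saitoDet {n : ℕ} (a : Fin n → Matrix (Fin n) (Fin n) ℂ) :
    (saitoDet a).IsHomogeneous n := by
  rw [saitoDet, Matrix.det_apply]
  refine IsHomogeneous.sum _ _ _ fun σ _ => ?_
  have h : (∏ i, (Matrix.of fun i j => linForm (a i j)) (σ i) i).IsHomogeneous n := by
    have := IsHomogeneous.prod Finset.univ
      (fun i => (Matrix.of fun i j => linForm (a i j)) (σ i) i) (fun _ => 1)
      fun i _ => isHomogeneous_linForm _
    simpa using this
  rw [Units.smul_def]
  exact (homogeneousSubmodule (Fin n) ℂ n).smul_of_tower_mem _ h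

section

variable {n : ℕ} {f : Coord n} {a : Fin n → Matrix (Fin n) (Fin n) ℂ}

theorem mem_logFields {δ : VectorField n} : δ ∈ logFields f ↔ f ∣ δ f := Iff.rfl

theorem dvd_saitoDet (hf : Squarefree f) (ha : ∀ i, linField (a i) ∈ logFields f) :
    f ∣ saitoDet a := by
  have key : ∀ j, f ∣ saitoDet a * pderiv j f := by
    intro j
    let S : Matrix (Fin n) (Fin n) (Coord n) := Matrix.of fun i j => linForm (a i j)
    have h1 : (S.adjugate * S).mulVec (fun k => pderiv k f) j = saitoDet a * pderiv j f := by
      rw [Matrix.adjugate_mul, Matrix.smul_mulVec, Matrix.one_mulVec]; rfl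
    rw [← h1, ← Matrix.mulVec_mulVec]
    rw [Matrix.mulVec.eq_1 S.adjugate, dotProduct]
    refine Finset.dvd_sum fun i _ => Dvd.dvd.mul_left ?_ _
    have h2 := mem_logFields.1 (ha i)
    rw [derivation_eq_sum_pderiv] at h2
    simpa [linField_X, S, Matrix.mulVec, dotProduct] using h2
  refine dvd_of_squarefree_of_forall_irreducible hf fun p hp hpf => ?_
  obtain ⟨j, hj⟩ := exists_not_dvd_pderiv hp
  have h := dvd_derivation_of_irreducible (δ := saitoDet a • pderiv j) hp hf.ne_zero hpf (key j)
  exact (hp.prime.dvd_or_dvd h).resolve_right hj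

theorem eval_saitoDet_ne_zero (hspan : ∀ δ ∈ logFields f, ∃ c : Fin n → Coord n,
    δ = ∑ i, c i • linField (a i)) {x : Fin n → ℂ} (hx : eval x f ≠ 0) :
    eval x (saitoDet a) ≠ 0 := by
  choose T hT using fun j : Fin n => hspan (f • pderiv j) (mem_logFields.2 (dvd_mul_right _ _))
  have h : (Matrix.of fun j i => eval x (T j i)) * (Matrix.of fun i => (a i).mulVec x) =
      eval x f • 1 := by
    ext j k
    have h1 := congrArg (eval x) (DFunLike.congr_fun (hT j) (X k))
    rw [derivation_sum_apply] at h1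
    simp only [Derivation.smul_apply, smul_eq_mul, linField_X, map_mul, map_sum, eval_linForm] at h1
    simp only [Matrix.mul_apply, Matrix.of_apply, Matrix.mulVec]
    rw [← h1]
    by_cases hjk : j = k
    · subst hjk; simp
    · simp [hjk, pderiv_X_of_ne (Ne.symm hjk)]
  rw [eval_saitoDet]
  intro h0
  have h2 := congrArg Matrix.det h
  rw [Matrix.det_mul, h0, mul_zero, Matrix.det_smul, Matrix.det_one, mul_one] at h2
  exact pow_ne_zero _ hx h2.symm

theorem eval_eq_zero_iff_det_eq_zero (hf : Squarefree f) (ha : ∀ i, linField (a i) ∈ logFields f)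
    (hspan : ∀ δ ∈ logFields f, ∃ c : Fin n → Coord n, δ = ∑ i, c i • linField (a i))
    (x : Fin n → ℂ) : eval x f = 0 ↔ (Matrix.of fun i => (a i).mulVec x).det = 0 := by
  rw [← eval_saitoDet]
  constructor
  · intro h
    obtain ⟨q, hq⟩ := dvd_saitoDet hf ha
    rw [hq, map_mul, h, zero_mul]
  · intro h
    by_contra h0
    exact eval_saitoDet_ne_zero hspan h0 h

theorem exists_eval_ne_zero {p : Coord n} (hp : p ≠ 0) : ∃ x, eval x p ≠ 0 := by
  by_contra! h
  exact hp (MvPolynomial.funext fun x => by rw [h x, map_zero])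

theorem euler_mem_logFields (hf : Squarefree f) (ha : ∀ i, linField (a i) ∈ logFields f)
    (hspan : ∀ δ ∈ logFields f, ∃ c : Fin n → Coord n, δ = ∑ i, c i • linField (a i)) :
    linField 1 ∈ logFields f := by
  have h0 : saitoDet a ≠ 0 := by
    obtain ⟨x, hx⟩ := exists_eval_ne_zero hf.ne_zero
    intro h
    exact eval_saitoDet_ne_zero hspan hx (by rw [h, map_zero])
  refine dvd_derivation_of_squarefree hf fun p hp hpf => ?_
  refine dvd_derivation_of_irreducible hp h0 (hpf.trans (dvd_saitoDet hf ha)) ?_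
  rw [linField_one_of_isHomogeneous (isHomogeneous_saitoDet a), nsmul_eq_mul]
  exact dvd_mul_left _ _

theorem eq_zero_of_constant_mem_logFields
    (hspan : ∀ δ ∈ logFields f, ∃ c : Fin n → Coord n, δ = ∑ i, c i • linField (a i))
    {v : Fin n → ℂ} (hv : mkDerivation ℂ (fun j => C (v j)) ∈ logFields f) : v = 0 := by
  obtain ⟨c, hc⟩ := hspan _ hv
  funext k
  have h1 := congrArg (eval 0) (DFunLike.congr_fun hc (X k))
  rw [derivation_sum_apply] at h1
  simpa only [Derivation.smul_apply, smul_eq_mul, linField_X, mkDerivation_X, map_sum, map_mul,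
    eval_linForm, eval_C, Pi.zero_apply, dotProduct_zero, mul_zero, Finset.sum_const_zero] using h1

theorem IsLinearFree.exists_matrices (h : IsLinearFree f) :
    ∃ a : Fin n → Matrix (Fin n) (Fin n) ℂ, (∀ i, linField (a i) ∈ logFields f) ∧
      ∀ δ ∈ logFields f, ∃ c : Fin n → Coord n, δ = ∑ i, c i • linField (a i) := by
  obtain ⟨b, hb⟩ := h
  choose a ha using fun i => (hb i).exists_eq_linField
  refine ⟨a, fun i => ha i ▸ (b i).2, fun δ hδ => ⟨b.repr ⟨δ, hδ⟩, ?_⟩⟩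
  have h1 := congrArg Subtype.val (b.sum_repr ⟨δ, hδ⟩)
  rw [AddSubmonoidClass.coe_finsetSum] at h1
  simpa only [Submodule.coe_smul, ha] using h1.symm

end

theorem exists_character_eq_zero {R : Type*} [CommRing R] [Algebra ℂ R] [Module.Finite ℂ R]
    {x : R} (hx : ¬ IsUnit x) : ∃ χ : R →ₐ[ℂ] ℂ, χ x = 0 := by
  obtain ⟨I, hI, hxI⟩ := exists_max_ideal_of_mem_nonunits (mem_nonunits_iff.2 hx)
  let : Field (R ⧸ I) := Ideal.Quotient.field I
  have hb : Function.Bijective (Algebra.ofId ℂ (R ⧸ I)) :=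
    IsAlgClosed.algebraMap_bijective_of_isIntegral (k := ℂ) (K := R ⧸ I)
  let e := AlgEquiv.ofBijective (Algebra.ofId ℂ (R ⧸ I)) hb
  refine ⟨(e.symm : (R ⧸ I) →ₐ[ℂ] ℂ).comp (Ideal.Quotient.mkₐ ℂ I), ?_⟩
  have : Ideal.Quotient.mkₐ ℂ I x = 0 := Ideal.Quotient.eq_zero_iff_mem.2 hxI
  rw [AlgHom.comp_apply, this, map_zero]

theorem dvd_of_forall_eval_eq_zero {n : ℕ} {f g : Coord n} (hf : Squarefree f)
    (h : ∀ x, eval x f = 0 → eval x g = 0) : f ∣ g := by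
  have hg : g ∈ (Ideal.span {f}).radical := by
    rw [← vanishingIdeal_zeroLocus_eq_radical (K := ℂ)]
    intro x hx
    have h1 := hx f (Ideal.mem_span_singleton_self f)
    rw [aeval_eq_eval] at h1 ⊢
    exact h x h1
  obtain ⟨k, hk⟩ := hg
  exact hf.isRadical k g (Ideal.mem_span_singleton.1 hk)

theorem associated_prod_linForm {n : ℕ} {f : Coord n} (hf : Squarefree f) {ι : Type*} [Fintype ι]
    {l : ι → Fin n → ℂ} (hl : LinearIndependent ℂ l)
    (h : ∀ x, eval x f = 0 ↔ ∃ i, l i ⬝ᵥ x = 0) : Associated f (∏ i, linForm (l i)) := by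
  have hirr i : Irreducible (linForm (l i)) := irreducible_linForm (hl.ne_zero i)
  refine associated_of_dvd_dvd ?_ ?_
  · refine dvd_of_forall_eval_eq_zero hf fun x hx => ?_
    obtain ⟨i, hi⟩ := (h x).1 hx
    rw [eval_prod]
    exact Finset.prod_eq_zero (Finset.mem_univ i) (by rw [eval_linForm, hi])
  · refine Finset.prod_dvd_of_isRelPrime ?_ fun i _ =>
      dvd_of_forall_eval_eq_zero (hirr i).squarefree fun x hx =>
        (h x).2 ⟨i, by rwa [eval_linForm] at hx⟩
    intro i _ j _ hij
    change IsRelPrime _ _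
    rw [(hirr i).isRelPrime_iff_not_dvd]
    intro hd
    obtain ⟨u, hu⟩ := (hirr i).associated_of_dvd (hirr j) hd
    obtain ⟨t, -, ht⟩ := MvPolynomial.isUnit_iff_eq_C_of_isReduced.1 u.isUnit
    rw [ht, mul_comm, ← linForm_smul] at hu
    have h1 := linForm_injective hu
    refine hl.notMem_span_image (s := {i}) (x := j) (fun hm => hij hm.symm) ?_
    rw [Set.image_singleton, ← h1]
    exact Submodule.smul_mem _ _ (Submodule.mem_span_singleton_self _)

open scoped IsMulCommutative in
theorem exists_linearIndependent_forms {n : ℕ} {f : Coord n} (hf : Squarefree f)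
    {a : Fin n → Matrix (Fin n) (Fin n) ℂ} (hcomm : ∀ i j, a i * a j = a j * a i)
    (h : ∀ x, eval x f = 0 ↔ (Matrix.of fun i => (a i).mulVec x).det = 0) :
    ∃ (ι : Type) (_ : Fintype ι) (l : ι → Fin n → ℂ), LinearIndependent ℂ l ∧
      Associated f (∏ i, linForm (l i)) := by
  obtain ⟨v, hv⟩ := exists_eval_ne_zero hf.ne_zero
  have hv' := mt (h v).2 hv
  have hspan : ⊤ ≤ Submodule.span ℂ (Set.range fun i => (a i).mulVec v) := by
    have hli : LinearIndependent ℂ fun i => (a i).mulVec v :=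
      Matrix.linearIndependent_rows_of_det_ne_zero hv'
    exact (hli.span_eq_top_of_card_eq_finrank' (by simp)).ge
  let R := Algebra.adjoin ℂ (Set.range a)
  have : IsMulCommutative R := Algebra.isMulCommutative_adjoin ℂ (by
    rintro _ ⟨i, rfl⟩ _ ⟨j, rfl⟩; exact hcomm i j)
  have hcommR (b : R) (i) : b.1 * a i = a i * b.1 :=
    congrArg Subtype.val (mul_comm b ⟨a i, Algebra.subset_adjoin ⟨i, rfl⟩⟩)
  let ev : R →ₗ[ℂ] (Fin n → ℂ) :=
    { toFun := fun b => b.1.mulVec v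
      map_add' := fun b c => Matrix.add_mulVec _ _ _
      map_smul' := fun t b => Matrix.smul_mulVec _ _ _ }
  have hinj : Function.Injective ev := by
    rw [← LinearMap.ker_eq_bot, LinearMap.ker_eq_bot']
    intro b hb
    have hb' : b.1.mulVec v = 0 := hb
    have hz : Matrix.mulVecLin b.1 = 0 := by
      refine LinearMap.ext_on_range (v := fun i => (a i).mulVec v) (top_le_iff.1 hspan) fun i => ?_
      rw [Matrix.mulVecLin_apply, Matrix.mulVec_mulVec, hcommR, ← Matrix.mulVec_mulVec, hb',
        Matrix.mulVec_zero, LinearMap.zero_apply]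
    have h0 : b.1 = 0 := Matrix.toLin'.injective (by rw [Matrix.toLin'_apply', hz, map_zero])
    exact Subtype.ext h0
  have hsurj : Function.Surjective ev := by
    rw [← LinearMap.range_eq_top, ← top_le_iff]
    refine hspan.trans (Submodule.span_le.2 ?_)
    rintro _ ⟨i, rfl⟩
    exact ⟨⟨a i, Algebra.subset_adjoin ⟨i, rfl⟩⟩, rfl⟩
  let e := LinearEquiv.ofBijective ev ⟨hinj, hsurj⟩
  have he (x) : (e.symm x).1.mulVec v = x := e.apply_symm_apply x
  have hfin : Module.Finite ℂ R := inferInstance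
  have hart : IsArtinianRing R := IsArtinianRing.of_finite ℂ R
  have hunit (b : R) : IsUnit b ↔ b.1.det ≠ 0 := by
    constructor
    · intro hb
      exact ((Matrix.isUnit_iff_isUnit_det _).1 (hb.map R.val)).ne_zero
    · intro hb
      refine IsArtinianRing.isUnit_of_mem_nonZeroDivisors ?_
      rw [mem_nonZeroDivisors_iff_right]
      intro c hc
      have h1 : c.1 * b.1 = 0 := congrArg Subtype.val hc
      have h2 := congrArg (· * b.1⁻¹) h1
      simp only [zero_mul] at h2
      rw [Matrix.mul_nonsing_inv_cancel_right _ _ (isUnit_iff_ne_zero.2 hb)] at h2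
      exact Subtype.ext h2
  have hdet (x) : (Matrix.of fun i => (a i).mulVec x).det =
      (Matrix.of fun i => (a i).mulVec v).det * (e.symm x).1.det := by
    rw [← Matrix.det_transpose (e.symm x).1, ← Matrix.det_mul]
    congr 1
    ext i j
    have h1 : (a i).mulVec x = (e.symm x).1.mulVec ((a i).mulVec v) := by
      rw [Matrix.mulVec_mulVec, hcommR, ← Matrix.mulVec_mulVec, he]
    rw [Matrix.of_apply, h1]
    simp [Matrix.mul_apply, Matrix.mulVec, dotProduct, mul_comm]
  let l : (R →ₐ[ℂ] ℂ) → Fin n → ℂ := fun χ j => χ (e.symm (Pi.single j 1))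
  have hl (χ : R →ₐ[ℂ] ℂ) (x) : l χ ⬝ᵥ x = χ (e.symm x) := by
    conv_rhs => rw [← Finset.univ_sum_single x]
    rw [map_sum, map_sum, dotProduct]
    refine Finset.sum_congr rfl fun j _ => ?_
    have h1 : (Pi.single j (x j) : Fin n → ℂ) = x j • Pi.single j 1 := by
      rw [← Pi.single_smul', smul_eq_mul, mul_one]
    rw [h1, map_smul, map_smul, smul_eq_mul, mul_comm]
  have hli : LinearIndependent ℂ l := by
    have h1 := linearIndependent_algHom_toLinearMap ℂ R ℂ
    rw [linearIndependent_iff'] at h1 ⊢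
    intro s g hg
    refine h1 s g (LinearMap.ext fun b => ?_)
    have h2 := congrArg (· ⬝ᵥ e b) hg
    simp only [sum_dotProduct, smul_dotProduct, hl, zero_dotProduct,
      LinearEquiv.symm_apply_apply] at h2
    simpa [LinearMap.sum_apply] using h2
  let := Fintype.ofFinite (R →ₐ[ℂ] ℂ)
  refine ⟨R →ₐ[ℂ] ℂ, inferInstance, l, hli, associated_prod_linForm hf hli fun x => ?_⟩
  rw [h, hdet, mul_eq_zero, or_iff_right hv', ← not_iff_not, ← ne_eq, ← hunit]
  simp only [hl]
  constructor
  · rintro hu ⟨χ, hχ⟩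
    exact (hu.map χ).ne_zero hχ
  · intro hno
    by_contra hu
    exact hno (exists_character_eq_zero hu)

theorem isNormalCrossing_of_commute {n : ℕ} {f : Coord n} (hf : Squarefree f)
    {a : Fin n → Matrix (Fin n) (Fin n) ℂ} (hcomm : ∀ i j, a i * a j = a j * a i)
    (ha : ∀ i, linField (a i) ∈ logFields f)
    (hspan : ∀ δ ∈ logFields f, ∃ c : Fin n → Coord n, δ = ∑ i, c i • linField (a i)) :
    IsNormalCrossing f := by
  obtain ⟨ι, _, l, hl, hassoc⟩ :=
    exists_linearIndependent_forms hf hcomm (eval_eq_zero_iff_det_eq_zero hf ha hspan)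
  have hker : ∀ v : Fin n → ℂ, (∀ i, l i ⬝ᵥ v = 0) → v = 0 := by
    intro v hv
    let D : VectorField n := mkDerivation ℂ fun j => C (v j)
    refine eq_zero_of_constant_mem_logFields hspan (mem_logFields.2 (?_ : f ∣ D f))
    obtain ⟨u, hu⟩ := hassoc.symm
    rw [← hu]
    refine mul_dvd_derivation_mul ?_ u.isUnit.dvd
    refine Finset.prod_induction _ (fun p => p ∣ D p)
      (fun p q => mul_dvd_derivation_mul) (one_dvd _) fun i _ => ?_
    have h0 : D (linForm (l i)) = 0 := by
      rw [derivation_apply_linForm]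
      simp only [D, mkDerivation_X, ← C_mul, ← map_sum]
      rw [← C_0]
      exact congrArg C (hv i)
    rw [h0]
    exact dvd_zero _
  have hcard : Fintype.card ι = Fintype.card (Fin n) := by
    refine le_antisymm (by simpa using hl.fintype_card_le_finrank) ?_
    have hinj : Function.Injective (Matrix.mulVecLin (Matrix.of l)) := by
      rw [← LinearMap.ker_eq_bot, LinearMap.ker_eq_bot']
      exact fun v hv => hker v fun i => congrFun hv i
    simpa using LinearMap.finrank_le_finrank_of_injective hinj
  let σ := Fintype.equivOfCardEq hcard
  have hu : IsUnit (Matrix.of fun i => l (σ.symm i)) :=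
    Matrix.linearIndependent_rows_iff_isUnit.1 (hl.comp _ σ.symm.injective)
  refine ⟨hu.unit, ?_⟩
  rw [← Equiv.prod_comp σ.symm] at hassoc
  exact hassoc

theorem hasDerivAt_eval {n : ℕ} {γ : ℝ → Fin n → ℂ} {a : Matrix (Fin n) (Fin n) ℂ} {t : ℝ}
    (hγ : HasDerivAt γ (a.mulVec (γ t)) t) (p : Coord n) :
    HasDerivAt (fun s => eval (γ s) p) (eval (γ t) (linField a p)) t := by
  induction p using MvPolynomial.induction_on with
  | C r => simpa using hasDerivAt_const t r
  | add p q hp hq => simp only [map_add]; exact hp.add hq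
  | mul_X p i hp =>
    have hi : HasDerivAt (fun s => γ s i) (a.mulVec (γ t) i) t := hasDerivAt_pi.1 hγ i
    simp only [map_mul, eval_X]
    refine (hp.mul hi).congr_deriv ?_
    rw [Derivation.leibniz, linField_X]
    simp only [smul_eq_mul, map_add, map_mul, eval_X, eval_linForm, Matrix.mulVec]
    ring

section Exp

attribute [local instance] Matrix.linftyOpNormedRing Matrix.linftyOpNormedAlgebra

variable {n : ℕ}

theorem hasDerivAt_matrix_exp (a : Matrix (Fin n) (Fin n) ℂ) (t : ℝ) :
    HasDerivAt (fun s : ℝ => NormedSpace.exp (s • a)) (a * NormedSpace.exp (t • a)) t :=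
  hasDerivAt_exp_smul_const' a t

/-- The one-parameter group `t ↦ exp(t a)`. -/
noncomputable def expHom (a : Matrix (Fin n) (Fin n) ℂ) : Multiplicative ℝ →* GL (Fin n) ℂ :=
  MonoidHom.toHomUnits
    { toFun := fun t => NormedSpace.exp (t.toAdd • a)
      map_one' := by simp
      map_mul' := fun s t => by
        rw [toAdd_mul, add_smul]
        exact Matrix.exp_add_of_commute _ _ ((Commute.refl a).smul_left _ |>.smul_right _) }

theorem coe_expHom (a : Matrix (Fin n) (Fin n) ℂ) (t : ℝ) :
    (expHom a (Multiplicative.ofAdd t)).val = NormedSpace.exp (t • a) := rfl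

theorem isConnected_range_expHom (a : Matrix (Fin n) (Fin n) ℂ) :
    @IsConnected (GL (Fin n) ℂ) (zariski n) ((expHom a).range : Set (GL (Fin n) ℂ)) := by
  let := zariski n
  have hcont : Continuous fun t : ℝ => expHom a (Multiplicative.ofAdd t) := by
    refine continuous_generateFrom_iff.2 ?_
    rintro _ ⟨p, rfl⟩
    have h : Continuous fun t : ℝ =>
        eval (fun ij : Fin n × Fin n => (expHom a (Multiplicative.ofAdd t)) ij.1 ij.2) p := by
      have h0 : Continuous fun t : ℝ => NormedSpace.exp (t • a) :=
        continuous_iff_continuousAt.2 fun t => (hasDerivAt_matrix_exp a t).continuousAt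
      refine (MvPolynomial.continuous_eval p).comp (continuous_pi fun ij => ?_)
      exact h0.matrix_elem ij.1 ij.2
    exact h.isOpen_preimage _ isOpen_ne
  have h := isConnected_range hcont
  have hr : ((expHom a).range : Set (GL (Fin n) ℂ)) =
      Set.range fun t : ℝ => expHom a (Multiplicative.ofAdd t) := rfl
  rw [hr]
  exact h

theorem expHom_mem_isotropy {f : Coord n} {a : Matrix (Fin n) (Fin n) ℂ}
    (ha : linField a f = 0) (t : ℝ) : expHom a (Multiplicative.ofAdd t) ∈ isotropy f := by
  intro x
  have hd (s : ℝ) : HasDerivAt (fun s : ℝ => (NormedSpace.exp (s • a)).mulVec x)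
      (a.mulVec ((NormedSpace.exp (s • a)).mulVec x)) s := by
    rw [Matrix.mulVec_mulVec]
    let L : Matrix (Fin n) (Fin n) ℂ →L[ℝ] (Fin n → ℂ) := LinearMap.toContinuousLinearMap
      { toFun := fun m => m.mulVec x
        map_add' := fun b c => Matrix.add_mulVec _ _ _
        map_smul' := fun t b => Matrix.smul_mulVec _ _ _ }
    exact L.hasFDerivAt.comp_hasDerivAt s (hasDerivAt_matrix_exp a s)
  have h0 (s : ℝ) : HasDerivAt (fun s : ℝ => eval ((NormedSpace.exp (s • a)).mulVec x) f) 0 s := by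
    have := hasDerivAt_eval (hd s) f
    rwa [ha, map_zero] at this
  have hconst := is_const_of_deriv_eq_zero (fun s => (h0 s).differentiableAt)
    (fun s => (h0 s).deriv) t 0
  simpa [coe_expHom] using hconst

theorem expHom_mem_groupH {f : Coord n} {a : Matrix (Fin n) (Fin n) ℂ}
    (ha : linField a f = 0) (t : ℝ) : expHom a (Multiplicative.ofAdd t) ∈ groupH f := by
  have hle : (expHom a).range ≤ groupH f :=
    le_sSup ⟨by rintro _ ⟨s, rfl⟩; exact expHom_mem_isotropy ha s.toAdd,
      isConnected_range_expHom a⟩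
  exact hle ⟨_, rfl⟩

theorem mul_comm_of_forall_exp {a b : Matrix (Fin n) (Fin n) ℂ}
    (h : ∀ t : ℝ, NormedSpace.exp (t • a) * b = b * NormedSpace.exp (t • a)) :
    a * b = b * a := by
  have h1 := (hasDerivAt_matrix_exp a 0).mul_const b
  have h2 := (hasDerivAt_matrix_exp a 0).const_mul b
  rw [funext h] at h1
  simpa using h1.unique h2

theorem mul_comm_of_groupH {f : Coord n} (hH : IsMulCommutative (groupH f))
    {a b : Matrix (Fin n) (Fin n) ℂ} (ha : linField a f = 0) (hb : linField b f = 0) :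
    a * b = b * a := by
  refine mul_comm_of_forall_exp fun t => (mul_comm_of_forall_exp fun s => ?_).symm
  have h := congrArg Units.val (setLike_mul_comm (expHom_mem_groupH hb s) (expHom_mem_groupH ha t))
  exact h

end Exp

theorem isNormalCrossing_of_isMulCommutative_groupH {n : ℕ} {f : Coord n} (hf : Squarefree f)
    (hfree : IsLinearFree f) (hH : IsMulCommutative (groupH f)) : IsNormalCrossing f := by
  obtain ⟨a, ha, hspan⟩ := hfree.exists_matrices
  obtain ⟨d, hd⟩ := linField_apply_eq_C_mul_of_dvd (euler_mem_logFields hf ha hspan)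
  by_cases hd0 : d = 0
  · rw [hd0, C_0, zero_mul] at hd
    have hu : IsUnit f :=
      isUnit_of_totalDegree_eq_zero hf.ne_zero (totalDegree_eq_zero_of_linField_one hd)
    have hv (v : Fin n → ℂ) : v = 0 :=
      eq_zero_of_constant_mem_logFields hspan (mem_logFields.2 hu.dvd)
    obtain rfl : n = 0 := by
      by_contra hn
      exact one_ne_zero (congrFun (hv 1) ⟨0, Nat.pos_of_ne_zero hn⟩)
    exact ⟨1, by simpa using hu⟩
  · choose t ht using fun i => linField_apply_eq_C_mul_of_dvd (ha i)
    have hz i : linField (a i - (t i / d) • 1) f = 0 := by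
      rw [linField_sub, linField_smul, Derivation.sub_apply, Derivation.smul_apply, hd, ht,
        smul_eq_C_mul, ← mul_assoc, ← C_mul, div_mul_cancel₀ _ hd0, sub_self]
    refine isNormalCrossing_of_commute hf (fun i j => ?_) ha hspan
    have h := mul_comm_of_groupH hH (hz i) (hz j)
    have h1 : Commute (a i - (t i / d) • 1) (a j - (t j / d) • 1) := h
    have h2 : Commute (a i - (t i / d) • 1 + (t i / d) • 1) (a j - (t j / d) • 1 + (t j / d) • 1) :=
      (h1.add_left ((Commute.one_left _).smul_left _)).add_right
        ((Commute.one_right _).smul_right _)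
    simpa using h2.eq

section NormalCrossing

variable {n : ℕ} {f : Coord n} {g : GL (Fin n) ℂ}

theorem row_ne_zero (g : GL (Fin n) ℂ) (i : Fin n) : g.val i ≠ 0 := fun h => by
  have hd : g.val.det = 0 := Matrix.det_eq_zero_of_row_eq_zero i fun j => congrFun h j
  exact ((Matrix.isUnit_iff_isUnit_det _).1 g.isUnit).ne_zero hd

/-- The vector field `yᵢ ∂/∂yᵢ` in the linear coordinates `y = g x`. -/
noncomputable def coordField (g : GL (Fin n) ℂ) (i : Fin n) : VectorField n :=
  mkDerivation ℂ fun j => C (g⁻¹.val j i) * linForm (g.val i)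

theorem coordField_linForm (g : GL (Fin n) ℂ) (i k : Fin n) :
    coordField g i (linForm (g.val k)) = if k = i then linForm (g.val i) else 0 := by
  have h : ∑ j, g.val k j * g⁻¹.val j i = if k = i then 1 else 0 := by
    rw [← Matrix.mul_apply, Units.mul_inv, Matrix.one_apply]
  rw [derivation_apply_linForm]
  simp only [coordField, mkDerivation_X, ← mul_assoc, ← C_mul, ← Finset.sum_mul]
  rw [← map_sum, h]
  split_ifs <;> simp

theorem isLinearField_coordField (g : GL (Fin n) ℂ) (i : Fin n) :
    IsLinearField (coordField g i) := fun j => by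
  rw [coordField, mkDerivation_X]
  exact (isHomogeneous_linForm _).C_mul _

theorem derivation_ext_linForm {δ ε : VectorField n} (g : GL (Fin n) ℂ)
    (h : ∀ k, δ (linForm (g.val k)) = ε (linForm (g.val k))) : δ = ε := by
  refine derivation_ext fun j => ?_
  have hX : (X j : Coord n) = ∑ k, C (g⁻¹.val j k) * linForm (g.val k) := by
    simp only [linForm, Finset.mul_sum, ← mul_assoc, ← C_mul]
    rw [Finset.sum_comm]
    simp only [← Finset.sum_mul, ← map_sum, ← Matrix.mul_apply, Units.inv_mul, Matrix.one_apply]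
    simp
  rw [hX, map_sum, map_sum]
  refine Finset.sum_congr rfl fun k _ => ?_
  simp only [Derivation.leibniz, derivation_C, h]

theorem mem_logFields_iff_forall_dvd (hf : Squarefree f)
    (hg : Associated f (∏ i, linForm (g.val i))) {δ : VectorField n} :
    δ ∈ logFields f ↔ ∀ i, linForm (g.val i) ∣ δ (linForm (g.val i)) := by
  constructor
  · intro h i
    have hi : linForm (g.val i) ∣ f :=
      (Finset.dvd_prod_of_mem (fun i => linForm (g.val i)) (Finset.mem_univ i)).trans hg.symm.dvd
    exact dvd_derivation_of_irreducible (irreducible_linForm (row_ne_zero g i)) hf.ne_zero hi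
      (mem_logFields.1 h)
  · intro h
    obtain ⟨u, hu⟩ := hg.symm
    rw [mem_logFields, ← hu]
    exact mul_dvd_derivation_mul (Finset.prod_induction _ (fun p => p ∣ δ p)
      (fun p q => mul_dvd_derivation_mul) (one_dvd _) fun i _ => h i) u.isUnit.dvd

theorem IsNormalCrossing.isLinearFree (hf : Squarefree f) (h : IsNormalCrossing f) :
    IsLinearFree f := by
  obtain ⟨g, hg⟩ := h
  change Associated f (∏ i, linForm (g.val i)) at hg
  have hmem i : coordField g i ∈ logFields f := by
    rw [mem_logFields_iff_forall_dvd hf hg]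
    intro k
    rw [coordField_linForm]
    split_ifs with hk
    · rw [hk]
    · exact dvd_zero _
  have hsum (c : Fin n → Coord n) (k : Fin n) :
      (∑ i, c i • coordField g i) (linForm (g.val k)) = c k * linForm (g.val k) := by
    rw [derivation_sum_apply]
    simp [coordField_linForm]
  let b : Fin n → logFields f := fun i => ⟨coordField g i, hmem i⟩
  have hcoe (c : Fin n → Coord n) : ((∑ i, c i • b i : logFields f) : VectorField n) =
      ∑ i, c i • coordField g i := by
    rw [AddSubmonoidClass.coe_finsetSum]
    simp only [Submodule.coe_smul, b]
  have hli : LinearIndependent (Coord n) b := by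
    refine Fintype.linearIndependent_iffₛ.2 fun c d hcd k => ?_
    have h1 := hsum c k
    rw [← hcoe c, hcd, hcoe d, hsum d k] at h1
    exact (mul_right_cancel₀ (irreducible_linForm (row_ne_zero g k)).ne_zero h1).symm
  have hspan : ⊤ ≤ Submodule.span (Coord n) (Set.range b) := by
    rintro ⟨δ, hδ⟩ -
    choose q hq using (mem_logFields_iff_forall_dvd hf hg).1 hδ
    have h1 : (⟨δ, hδ⟩ : logFields f) = ∑ i, q i • b i := by
      refine Subtype.ext ?_
      rw [hcoe]
      refine derivation_ext_linForm g fun k => ?_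
      rw [hsum, hq, mul_comm]
    rw [h1]
    exact Submodule.sum_mem _ fun i _ => Submodule.smul_mem _ _ (Submodule.subset_span ⟨i, rfl⟩)
  refine ⟨Module.Basis.mk hli hspan, fun i => ?_⟩
  rw [Module.Basis.mk_apply]
  exact isLinearField_coordField g i

theorem mem_hypersurface_iff (hg : Associated f (∏ i, linForm (g.val i))) {x : Fin n → ℂ} :
    x ∈ hypersurface f ↔ ∃ i, g.val.mulVec x i = 0 := by
  obtain ⟨u, hu⟩ := hg.symm
  have hu0 : eval x u.val ≠ 0 := (u.isUnit.map (eval x)).ne_zero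
  change eval x f = 0 ↔ _
  rw [← hu, map_mul, mul_eq_zero, or_iff_left hu0, eval_prod, Finset.prod_eq_zero_iff]
  simp [eval_linForm, Matrix.mulVec]

/-- A linear map preserving the union of the coordinate hyperplanes is monomial. -/
theorem exists_row_supported {m : Matrix (Fin n) (Fin n) ℂ}
    (h : ∀ y : Fin n → ℂ, (∃ i, y i = 0) → ∃ i, m.mulVec y i = 0) (i : Fin n) :
    ∃ j, ∀ k, k ≠ i → m j k = 0 := by
  have hprod : ∏ j, linForm (Function.update (m j) i 0) = 0 := by
    refine MvPolynomial.funext fun y => ?_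
    obtain ⟨j, hj⟩ := h (Function.update y i 0) ⟨i, by simp⟩
    rw [eval_prod, map_zero]
    refine Finset.prod_eq_zero (Finset.mem_univ j) ?_
    rw [eval_linForm]
    refine Eq.trans ?_ hj
    rw [Matrix.mulVec, dotProduct, dotProduct]
    refine Finset.sum_congr rfl fun k _ => ?_
    by_cases hk : k = i
    · subst hk; simp
    · simp [hk]
  obtain ⟨j, -, hj⟩ := Finset.prod_eq_zero_iff.1 hprod
  refine ⟨j, fun k hk => ?_⟩
  have h1 := congrFun (linForm_injective (hj.trans linForm_zero.symm)) k
  simpa [hk] using h1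

theorem isOpen_zariski_conj_entry (g : GL (Fin n) ℂ) (i j : Fin n) :
    @IsOpen _ (zariski n) {h : GL (Fin n) ℂ | (g * h * g⁻¹).val i j ≠ 0} := by
  refine TopologicalSpace.isOpen_generateFrom_of_mem
    ⟨∑ k, (∑ l, C (g.val i l) * X (l, k)) * C (g⁻¹.val k j), ?_⟩
  ext h
  simp [Matrix.mul_apply]

theorem conj_isDiag_of_isConnected (hg : Associated f (∏ i, linForm (g.val i)))
    {L : Subgroup (GL (Fin n) ℂ)} (hL : L ≤ preserver (hypersurface f))
    (hc : @IsConnected _ (zariski n) (L : Set (GL (Fin n) ℂ))) {h : GL (Fin n) ℂ} (hh : h ∈ L) :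
    (g * h * g⁻¹).val.IsDiag := by
  let := zariski n
  have hmon : ∀ h ∈ L, ∀ i, ∃ j, ∀ k, k ≠ i → (g * h * g⁻¹).val j k = 0 := by
    intro h hh
    refine exists_row_supported fun y hy => ?_
    have hx : g⁻¹.val.mulVec y ∈ hypersurface f := by
      rw [mem_hypersurface_iff hg, Matrix.mulVec_mulVec, Units.mul_inv, Matrix.one_mulVec]
      exact hy
    have hx' : h.val.mulVec (g⁻¹.val.mulVec y) ∈ hypersurface f := by
      rw [← (hL hh : _ '' hypersurface f = hypersurface f)]
      exact ⟨_, hx, rfl⟩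
    rw [mem_hypersurface_iff hg, Matrix.mulVec_mulVec, Matrix.mulVec_mulVec] at hx'
    simpa [mul_assoc] using hx'
  have hdiag : ∀ h ∈ L, (∀ i, (g * h * g⁻¹).val i i ≠ 0) → (g * h * g⁻¹).val.IsDiag := by
    intro h hh hne i k hik
    obtain ⟨j, hj⟩ := hmon h hh i
    obtain rfl : j = i := by
      by_contra hji
      exact hne j (hj j hji)
    exact hj k hik.symm
  let U : Set (GL (Fin n) ℂ) := ⋂ i, {h | (g * h * g⁻¹).val i i ≠ 0}
  let W : Set (GL (Fin n) ℂ) := ⋃ i, ⋃ j, ⋃ (_ : i ≠ j), {h | (g * h * g⁻¹).val i j ≠ 0}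
  have hU : IsOpen U := isOpen_iInter_of_finite fun i => isOpen_zariski_conj_entry g i i
  have hW : IsOpen W := isOpen_iUnion fun i => isOpen_iUnion fun j => isOpen_iUnion fun _ =>
    isOpen_zariski_conj_entry g i j
  have hUmem {h} : h ∈ U ↔ ∀ i, (g * h * g⁻¹).val i i ≠ 0 := Set.mem_iInter
  have hWmem {h} : h ∈ W ↔ ¬ (g * h * g⁻¹).val.IsDiag := by
    simp only [W, Set.mem_iUnion, Matrix.IsDiag, Pairwise]
    push Not
    simp only [Set.mem_ofPred_eq, exists_prop]
  have hcover : (L : Set (GL (Fin n) ℂ)) ⊆ U ∪ W := by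
    intro h hh
    by_cases hd : (g * h * g⁻¹).val.IsDiag
    · refine Or.inl (hUmem.2 fun i hi => row_ne_zero (g * h * g⁻¹) i ?_)
      funext j
      by_cases hij : i = j
      · rw [← hij]; exact hi
      · exact hd hij
    · exact Or.inr (hWmem.2 hd)
  have hdisj : (L : Set (GL (Fin n) ℂ)) ∩ (U ∩ W) = ∅ := by
    rw [Set.eq_empty_iff_forall_notMem]
    rintro h ⟨hh, hu, hw⟩
    exact hWmem.1 hw (hdiag h hh (hUmem.1 hu))
  rcases isPreconnected_iff_subset_of_disjoint.1 hc.isPreconnected U W hU hW hcover hdisj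
    with hsub | hsub
  · exact hdiag h hh (hUmem.1 (hsub hh))
  · exact absurd (by simp) (hWmem.1 (hsub L.one_mem))

theorem IsNormalCrossing.isMulCommutative_groupG (h : IsNormalCrossing f) :
    IsMulCommutative (groupG f) := by
  obtain ⟨g, hg⟩ := h
  change Associated f (∏ i, linForm (g.val i)) at hg
  have hle : groupG f ≤ Subgroup.closure {h | (g * h * g⁻¹).val.IsDiag} :=
    sSup_le fun L hL h hh =>
      Subgroup.subset_closure (conj_isDiag_of_isConnected hg hL.1 hL.2 hh)
  have hcomm : IsMulCommutative (Subgroup.closure {h | (g * h * g⁻¹).val.IsDiag}) := by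
    refine Subgroup.isMulCommutative_closure fun a ha b hb => ?_
    have h1 : (g * a * g⁻¹) * (g * b * g⁻¹) = (g * b * g⁻¹) * (g * a * g⁻¹) := by
      refine Units.ext ?_
      rw [Units.val_mul (g * a * g⁻¹), Units.val_mul (g * b * g⁻¹),
        ← Matrix.IsDiag.diagonal_diag ha, ← Matrix.IsDiag.diagonal_diag hb, Matrix.diagonal_mul_diagonal,
        Matrix.diagonal_mul_diagonal]
      simp only [mul_comm]
    rw [conj_mul, conj_mul] at h1
    exact mul_left_cancel (mul_right_cancel h1)
  exact .of_setLike_mul_comm fun a ha b hb => setLike_mul_comm (hle ha) (hle hb)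

end NormalCrossing

theorem isotropy_le_preserver {n : ℕ} (f : Coord n) :
    isotropy f ≤ preserver (hypersurface f) := by
  intro g hg
  change _ '' hypersurface f = hypersurface f
  ext x
  constructor
  · rintro ⟨y, hy, rfl⟩
    exact (hg y).trans hy
  · intro hx
    exact ⟨g⁻¹.val.mulVec x, ((isotropy f).inv_mem hg x).trans hx, by
      simp [Matrix.mulVec_mulVec]⟩

theorem groupH_le_groupG {n : ℕ} (f : Coord n) : groupH f ≤ groupG f :=
  sSup_le_sSup fun _ hL => ⟨hL.1.trans (isotropy_le_preserver f), hL.2⟩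

end LinearFreeDivisor

open LinearFreeDivisor

theorem mainTheorem11 {n : ℕ} (f : LinearFreeDivisor.Coord n) (hf : Squarefree f) :
    ((LinearFreeDivisor.IsLinearFree f ∧ IsMulCommutative (LinearFreeDivisor.groupG f)) ↔
      LinearFreeDivisor.IsNormalCrossing f) ∧
    ((LinearFreeDivisor.IsLinearFree f ∧ IsMulCommutative (LinearFreeDivisor.groupH f)) ↔
      LinearFreeDivisor.IsNormalCrossing f) := by
  have hGH : IsMulCommutative (groupG f) → IsMulCommutative (groupH f) := fun _ =>
    .of_setLike_mul_comm fun a ha b hb =>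
      setLike_mul_comm (groupH_le_groupG f ha) (groupH_le_groupG f hb)
  have hHn := fun h : IsLinearFree f ∧ IsMulCommutative (groupH f) =>
    isNormalCrossing_of_isMulCommutative_groupH hf h.1 h.2
  exact ⟨⟨fun h => hHn ⟨h.1, hGH h.2⟩, fun h => ⟨h.isLinearFree hf, h.isMulCommutative_groupG⟩⟩,
    ⟨hHn, fun h => ⟨h.isLinearFree hf, hGH h.isMulCommutative_groupG⟩⟩⟩
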